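/- Let $(Y,\mathrm d_Y)$ be an infinite compact metric space and $g:Y\to Y$ a continuous surjection satisfying Wieler's axioms: there are constants $\beta>0$, $K\in\mathbb N^+$, $0<\gamma<1$ such that $\mathrm d_Y(g^K(x),g^K(y))\le\gamma^K\mathrm d_Y(g^{2K}(x),g^{2K}(y))$ whenever $\mathrm d_Y(x,y)\le\beta$, and $g^K(B(g^K(x),\epsilon))\subseteq g^{2K}(B(x,\gamma\epsilon))$ for all $x\in Y$ and $0<\epsilon\le\beta$ (with $B$ denoting open balls). Let $X=\{(x_n)_{n\ge 0}\in Y^{\mathbb N}: g(x_{n+1})=x_n \text{ for all } n\}$ with the product topology and let $\varphi:X\to X$ be the homeomorphism $\varphi(x_0,x_1,\dots)=(g(x_0),x_0,x_1,\dots)$. Let $\mathrm d_X(\mathbf x,\mathbf y)=\sum_{i=0}^K\gamma^i\,\mathrm d'_X(\varphi^i(\mathbf x),\varphi^i(\mathbf y))$, where $\mathrm d'_X(\mathbf x,\mathbf y)=\sup_n\gamma^n\mathrm d_Y(x_n,y_n)$. For $0<\epsilon\le\beta/2$ let $X^u(\mathbf x,\epsilon)=\{\mathbf y\in X: \mathrm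 d_Y(x_n,y_n)<\epsilon \text{ for all } n, \ \mathrm d_X(\mathbf x,\mathbf y)<\epsilon\}$ be the local unstable set of $\mathbf x$. Let $P\subseteq X$ be a finite set of periodic points of $\varphi$ with $\varphi(P)=P$, and let $X^u(P)$ be the set of all $\mathbf x\in X$ with $\lim_{n\to\infty}\mathrm d_X(\varphi^{-n}(\mathbf x),\varphi^{-n}(p))=0$ for some $p\in P$, equipped with the topology in which the sets $X^u(\mathbf x,\delta)$, $\delta>0$, form a neighbourhood base at $\mathbf x$. Let $\pi_0(\mathbf x)=x_0$ and fix a constant $0<\epsilon_Y\le\beta/2$. For $\mathbf x,\mathbf y\in X^u(P)$ write $\mathbf x\sim_0\mathbf y$ if $x_0=y_0$ and there are $0<\delta<\epsilon_Y$ and an open set $U\subseteq X^u(\mathbf y,\epsilon_Y)$ of $X^u(P)$ with $\pi_0(X^u(\mathbf x,\delta))=\pi_0(U)$. This is an equivalence relation; give $X^u(P)/{\sim_0}$ the quotient topology, and let $\tilde g:X^u(P)/{\sim_0}\to X^u(P)/{\sim_0}$ be the well-defined map $[\mathbf x]\mapsto[\varphi(\mathbf x)]$. Call a self-map $f$ of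 a topological space mixing if for all non-empty open sets $U,V$ there is $N$ such that $f^n(U)\cap V\neq\emptyset$ for all $n\ge N$. Consider the statements 1. $(X,\varphi)$ is mixing; 2. $(X^u(P)/{\sim_0},\tilde g)$ is mixing; 3. $(Y,g)$ is mixing. Then (1) and (3) are equivalent, and (1) implies (2). If moreover $X^u(P)$ is dense in $X$ (for the product topology), then (1), (2) and (3) are equivalent. -/

import Mathlib

open Set Filter Topology

noncomputable section

namespace Wieler

/-- A self-map of a topological space is mixing if for all non-empty open sets `U`, `V` there is
`N` such that `f^n(U)` meets `V` for every `n ≥ N`. -/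
def IsMixing {Z : Type*} [TopologicalSpace Z] (f : Z → Z) : Prop :=
  ∀ U V : Set Z, IsOpen U → IsOpen V → U.Nonempty → V.Nonempty →
    ∃ N : ℕ, ∀ n : ℕ, N ≤ n → ((f^[n] '' U) ∩ V).Nonempty

/-- `(Y, d, g)` is a pre-solenoid: `g` is continuous and surjective and Wieler's two axioms hold
with the constants `β`, `γ`, `K` (the space `Y` is meant to be compact). -/
structure IsPresolenoid {Y : Type*} [MetricSpace Y] (g : Y → Y) (β γ : ℝ) (K : ℕ) : Prop where
  continuous : Continuous g
  surjective : Function.Surjective g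
  beta_pos : 0 < β
  K_pos : 0 < K
  gamma_pos : 0 < γ
  gamma_lt_one : γ < 1
  axiom_one : ∀ x y : Y, dist x y ≤ β →
    dist (g^[K] x) (g^[K] y) ≤ γ ^ K * dist (g^[2 * K] x) (g^[2 * K] y)
  axiom_two : ∀ (x : Y) (ε : ℝ), 0 < ε → ε ≤ β →
    g^[K] '' Metric.ball (g^[K] x) ε ⊆ g^[2 * K] '' Metric.ball x (γ * ε)

/-- The inverse limit of `Y ← Y ← Y ← ⋯` along `g`. -/
def Solenoid {Y : Type*} (g : Y → Y) : Type _ :=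
  {x : ℕ → Y // ∀ i, g (x (i + 1)) = x i}

/-- The solenoid carries the topology inherited from the product topology. -/
instance {Y : Type*} [TopologicalSpace Y] (g : Y → Y) : TopologicalSpace (Solenoid g) :=
  instTopologicalSpaceSubtype

/-- The homeomorphism `φ(x₀, x₁, …) = (g(x₀), g(x₁), …) = (g(x₀), x₀, x₁, …)` of the solenoid; its
inverse is the shift `(x₀, x₁, …) ↦ (x₁, x₂, …)`. -/
def phi {Y : Type*} (g : Y → Y) : Solenoid g ≃ Solenoid g where
  toFun x := ⟨fun n => g (x.1 n), fun i => congrArg g (x.2 i)⟩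
  invFun x := ⟨fun n => x.1 (n + 1), fun i => x.2 (i + 1)⟩
  left_inv x := Subtype.ext (funext fun n => x.2 n)
  right_inv x := Subtype.ext (funext fun n => x.2 n)

/-- `d'_X(x, y) = sup_n γ^n d_Y(x_n, y_n)`. -/
def distPre {Y : Type*} [MetricSpace Y] (g : Y → Y) (γ : ℝ) (x y : Solenoid g) : ℝ :=
  ⨆ n : ℕ, γ ^ n * dist (x.1 n) (y.1 n)

/-- Wieler's metric `d_X(x, y) = ∑_{i=0}^K γ^i d'_X(φ^i(x), φ^i(y))` on the solenoid. -/
def distX {Y : Type*} [MetricSpace Y] (g : Y → Y) (γ : ℝ) (K : ℕ) (x y : Solenoid g) : ℝ :=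
  ∑ i ∈ Finset.range (K + 1), γ ^ i * distPre g γ ((phi g)^[i] x) ((phi g)^[i] y)

/-- The local unstable set `X^u(x, ε)` of the solenoid. -/
def localUnstable {Y : Type*} [MetricSpace Y] (g : Y → Y) (γ : ℝ) (K : ℕ)
    (x : Solenoid g) (ε : ℝ) : Set (Solenoid g) :=
  {y | (∀ n, dist (x.1 n) (y.1 n) < ε) ∧ distX g γ K x y < ε}

/-- `x ∼ᵤ y`: the distance of `φ^{-n}(x)` and `φ^{-n}(y)` tends to `0`. -/
def UnstableEquiv {Y : Type*} [MetricSpace Y] (g : Y → Y) (γ : ℝ) (K : ℕ)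
    (x y : Solenoid g) : Prop :=
  Tendsto (fun n : ℕ => distX g γ K ((phi g).symm^[n] x) ((phi g).symm^[n] y)) atTop (𝓝 0)

/-- `X^u(P)`, as a subset of the solenoid. -/
def unstableSet {Y : Type*} [MetricSpace Y] (g : Y → Y) (γ : ℝ) (K : ℕ)
    (P : Set (Solenoid g)) : Set (Solenoid g) :=
  {x | ∃ p ∈ P, UnstableEquiv g γ K x p}

/-- `X^u(P)` as a space in its own right, which does not carry the subspace topology. -/
def UnstableSpace {Y : Type*} [MetricSpace Y] (g : Y → Y) (γ : ℝ) (K : ℕ)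
    (P : Set (Solenoid g)) : Type _ :=
  {x : Solenoid g // x ∈ unstableSet g γ K P}

/-- The (locally compact) topology of `X^u(P)`, in which the local unstable sets `X^u(x, δ)` form
a neighbourhood base at `x`. -/
instance {Y : Type*} [MetricSpace Y] (g : Y → Y) (γ : ℝ) (K : ℕ) (P : Set (Solenoid g)) :
    TopologicalSpace (UnstableSpace g γ K P) where
  IsOpen U := ∀ x ∈ U, ∃ δ : ℝ, 0 < δ ∧
    ∀ y : UnstableSpace g γ K P, y.1 ∈ localUnstable g γ K x.1 δ → y ∈ U
  isOpen_univ := fun _ _ => ⟨1, one_pos, fun _ _ => mem_univ _⟩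
  isOpen_inter := by
    intro U V hU hV x hx
    obtain ⟨a, ha, hUa⟩ := hU x hx.1
    obtain ⟨b, hb, hVb⟩ := hV x hx.2
    refine ⟨min a b, lt_min ha hb, fun y hy => ⟨hUa y ?_, hVb y ?_⟩⟩
    · exact ⟨fun n => (hy.1 n).trans_le (min_le_left _ _), hy.2.trans_le (min_le_left _ _)⟩
    · exact ⟨fun n => (hy.1 n).trans_le (min_le_right _ _), hy.2.trans_le (min_le_right _ _)⟩
  isOpen_sUnion := by
    intro S hS x hx
    obtain ⟨U, hU, hxU⟩ := hx
    obtain ⟨a, ha, h⟩ := hS U hU x hxU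
    exact ⟨a, ha, fun y hy => ⟨U, hU, h y hy⟩⟩

/-- `π₀ : X^u(P) → Y`, `x ↦ x₀`. -/
def piZero {Y : Type*} [MetricSpace Y] {g : Y → Y} {γ : ℝ} {K : ℕ} {P : Set (Solenoid g)}
    (x : UnstableSpace g γ K P) : Y :=
  x.1.1 0

/-- The local unstable set `X^u(x, δ)` of a point of `X^u(P)`, as a subset of `X^u(P)`. -/
def unstableBall {Y : Type*} [MetricSpace Y] {g : Y → Y} {γ : ℝ} {K : ℕ} {P : Set (Solenoid g)}
    (x : UnstableSpace g γ K P) (δ : ℝ) : Set (UnstableSpace g γ K P) :=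
  {y | y.1 ∈ localUnstable g γ K x.1 δ}

/-- The relation `x ∼₀ y` on `X^u(P)`, with respect to the constant `ε`. -/
def RelZero {Y : Type*} [MetricSpace Y] {g : Y → Y} {γ : ℝ} {K : ℕ} {P : Set (Solenoid g)}
    (ε : ℝ) (x y : UnstableSpace g γ K P) : Prop :=
  piZero x = piZero y ∧
    ∃ δ : ℝ, 0 < δ ∧ δ < ε ∧ ∃ U : Set (UnstableSpace g γ K P),
      IsOpen U ∧ U ⊆ unstableBall y ε ∧ piZero '' unstableBall x δ = piZero '' U

section Helpers

set_option linter.unusedSectionVars false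

/-! Facts showing that `∼₀` is an equivalence relation preserved by `φ`. -/

variable {Y : Type*} [MetricSpace Y] [CompactSpace Y] {g : Y → Y} {β γ ε : ℝ} {K : ℕ}
  {P : Set (Solenoid g)}

theorem phi_iterate_coord (i : ℕ) (x : Solenoid g) (n : ℕ) :
    ((phi g)^[i] x).1 n = g^[i] (x.1 n) := by
  induction i generalizing x with
  | zero => rfl
  | succ i ih =>
    rw [Function.iterate_succ_apply, ih, Function.iterate_succ_apply]; rfl

theorem iterate_coord (x : Solenoid g) (i n : ℕ) : g^[i] (x.1 (n + i)) = x.1 n := by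
  induction i generalizing n with
  | zero => rfl
  | succ i ih =>
    rw [Function.iterate_succ_apply, ← add_assoc, x.2, ih]

theorem bddAbove_distPre (hγ : 0 < γ) (hγ' : γ < 1) (x y : Solenoid g) :
    BddAbove (range fun n : ℕ => γ ^ n * dist (x.1 n) (y.1 n)) := by
  refine ⟨Metric.diam (univ : Set Y), ?_⟩
  rintro _ ⟨n, rfl⟩
  have h1 : dist (x.1 n) (y.1 n) ≤ Metric.diam (univ : Set Y) :=
    Metric.dist_le_diam_of_mem isCompact_univ.isBounded (mem_univ _) (mem_univ _)
  have h2 : γ ^ n ≤ 1 := pow_le_one₀ hγ.le hγ'.le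
  exact (mul_le_of_le_one_left dist_nonneg h2).trans h1

theorem distPre_triangle (hγ : 0 < γ) (hγ' : γ < 1) (x y z : Solenoid g) :
    distPre g γ x z ≤ distPre g γ x y + distPre g γ y z := by
  refine ciSup_le fun n => ?_
  have h1 := le_ciSup (bddAbove_distPre hγ hγ' x y) n
  have h2 := le_ciSup (bddAbove_distPre hγ hγ' y z) n
  have h3 := mul_le_mul_of_nonneg_left (dist_triangle (x.1 n) (y.1 n) (z.1 n)) (pow_pos hγ n).le
  rw [mul_add] at h3
  exact h3.trans (add_le_add h1 h2)

theorem distX_triangle (hγ : 0 < γ) (hγ' : γ < 1) (x y z : Solenoid g) :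
    distX g γ K x z ≤ distX g γ K x y + distX g γ K y z := by
  unfold distX
  rw [← Finset.sum_add_distrib]
  refine Finset.sum_le_sum fun i _ => ?_
  rw [← mul_add]
  exact mul_le_mul_of_nonneg_left (distPre_triangle hγ hγ' _ _ _) (pow_pos hγ i).le

theorem exists_modulus (hg : Continuous g) (m : ℕ) {η : ℝ} (hη : 0 < η) :
    ∃ ρ > 0, ∀ i ≤ m, ∀ a b : Y, dist a b < ρ → dist (g^[i] a) (g^[i] b) < η := by
  induction m with
  | zero =>
    refine ⟨η, hη, fun i hi a b h => ?_⟩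
    obtain rfl : i = 0 := by omega
    exact h
  | succ m ih =>
    obtain ⟨ρ, hρ, h⟩ := ih
    obtain ⟨ρ', hρ', h'⟩ := Metric.uniformContinuous_iff.1
      (CompactSpace.uniformContinuous_of_continuous (hg.iterate (m + 1))) η hη
    refine ⟨min ρ ρ', lt_min hρ hρ', fun i hi a b hab => ?_⟩
    rcases Nat.lt_or_ge m i with hi' | hi'
    · obtain rfl : i = m + 1 := by omega
      exact h' (hab.trans_le (min_le_right _ _))
    · exact h i hi' a b (hab.trans_le (min_le_left _ _))

/-- Points with uniformly close coordinates are in a small local unstable set of each other. -/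
theorem mem_of_coord (hW : IsPresolenoid g β γ K) {η : ℝ} (hη : 0 < η) :
    ∃ ρ > 0, ∀ x y : Solenoid g, (∀ n, dist (x.1 n) (y.1 n) < ρ) →
      y ∈ localUnstable g γ K x η := by
  have hK : (0 : ℝ) < (K : ℝ) + 2 := by positivity
  obtain ⟨ρ, hρ, h⟩ := exists_modulus hW.continuous K (div_pos hη hK)
  refine ⟨min ρ η, lt_min hρ hη, fun x y hxy => ⟨fun n => (hxy n).trans_le (min_le_right _ _), ?_⟩⟩
  have hi : ∀ i ∈ Finset.range (K + 1),
      γ ^ i * distPre g γ ((phi g)^[i] x) ((phi g)^[i] y) ≤ η / ((K : ℝ) + 2) := by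
    intro i hi
    have h0 : distPre g γ ((phi g)^[i] x) ((phi g)^[i] y) ≤ η / ((K : ℝ) + 2) := by
      refine ciSup_le fun n => ?_
      rw [phi_iterate_coord, phi_iterate_coord]
      have h1 := (h i (by simpa [Nat.lt_succ_iff] using hi) _ _
        ((hxy n).trans_le (min_le_left _ _))).le
      exact (mul_le_of_le_one_left dist_nonneg
        (pow_le_one₀ hW.gamma_pos.le hW.gamma_lt_one.le)).trans h1
    refine (mul_le_mul_of_nonneg_left h0 (pow_pos hW.gamma_pos i).le).trans ?_
    exact mul_le_of_le_one_left (div_pos hη hK).le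
      (pow_le_one₀ hW.gamma_pos.le hW.gamma_lt_one.le)
  refine (Finset.sum_le_sum hi).trans_lt ?_
  rw [Finset.sum_const, Finset.card_range, nsmul_eq_mul]
  push_cast
  rw [mul_div_assoc', div_lt_iff₀ hK]
  nlinarith

theorem dist_coord_mul_K (hW : IsPresolenoid g β γ K) {x y : Solenoid g}
    (hxy : ∀ n, dist (x.1 n) (y.1 n) ≤ β) (n j : ℕ) :
    dist (x.1 (n + j * K)) (y.1 (n + j * K)) ≤ γ ^ (j * K) * dist (x.1 n) (y.1 n) := by
  induction j with
  | zero => simp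
  | succ j ih =>
    have h := hW.axiom_one _ _ (hxy (n + j * K + 2 * K))
    rw [iterate_coord, iterate_coord] at h
    have e : n + j * K + 2 * K = n + (j + 1) * K + K := by ring
    rw [e, iterate_coord, iterate_coord] at h
    refine h.trans ?_
    have := mul_le_mul_of_nonneg_left ih (pow_pos hW.gamma_pos K).le
    refine this.trans (le_of_eq ?_)
    ring

/-- On sets with coordinates pairwise within `β`, the `0`-th coordinate controls the others. -/
theorem coord_of_zero (hW : IsPresolenoid g β γ K) {η : ℝ} (hη : 0 < η) :
    ∃ ρ > 0, ∀ x y : Solenoid g, (∀ n, dist (x.1 n) (y.1 n) ≤ β) →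
      ∀ m, dist (x.1 m) (y.1 m) < ρ → ∀ n, dist (x.1 (m + n)) (y.1 (m + n)) < η := by
  obtain ⟨ρ, hρ, h⟩ := exists_modulus hW.continuous K hη
  refine ⟨ρ, hρ, fun x y hxy m hm n => ?_⟩
  have hn : m + n + (K - n % K) = m + (n / K + 1) * K := by
    have h1 := Nat.div_add_mod n K
    have h2 := Nat.mod_lt n hW.K_pos
    rw [add_mul, one_mul, mul_comm (n / K) K]
    omega
  rw [← iterate_coord x (K - n % K), ← iterate_coord y (K - n % K), hn]
  refine h _ (Nat.sub_le _ _) _ _ ((dist_coord_mul_K hW hxy m _).trans_lt ?_)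
  exact (mul_le_of_le_one_left dist_nonneg
    (pow_le_one₀ hW.gamma_pos.le hW.gamma_lt_one.le)).trans_lt hm

theorem dist_le_of_mem {x a b : Solenoid g} (hε : ε ≤ β / 2) (ha : a ∈ localUnstable g γ K x ε)
    (hb : b ∈ localUnstable g γ K x ε) (n : ℕ) : dist (a.1 n) (b.1 n) ≤ β := by
  have h1 := dist_triangle_left (a.1 n) (b.1 n) (x.1 n)
  linarith [ha.1 n, hb.1 n]

theorem mem_self (hW : IsPresolenoid g β γ K) {δ : ℝ} (hδ : 0 < δ) (x : Solenoid g) :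
    x ∈ localUnstable g γ K x δ := by
  obtain ⟨ρ, hρ, h⟩ := mem_of_coord hW hδ
  exact h x x fun n => by simpa using hρ

theorem injOn_piZero (hW : IsPresolenoid g β γ K) (hε : ε ≤ β / 2)
    (x : UnstableSpace g γ K P) : InjOn piZero (unstableBall x ε) := by
  intro a ha b hb hab
  have hd := dist_le_of_mem hε ha hb
  refine Subtype.ext (Subtype.ext (funext fun n => ?_))
  refine eq_of_forall_dist_le fun η hη => ?_
  obtain ⟨ρ, hρ, h⟩ := coord_of_zero hW hη
  have := h a.1 b.1 hd 0 (by
    have e : a.1.1 0 = b.1.1 0 := hab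
    rw [e, dist_self]; exact hρ) n
  rw [zero_add] at this
  exact this.le

theorem isOpen_unstableBall (hW : IsPresolenoid g β γ K) (hε : ε ≤ β / 2)
    (x : UnstableSpace g γ K P) : IsOpen (unstableBall x ε) := by
  intro z hz
  have hε0 : 0 < ε := dist_nonneg.trans_lt (hz.1 0)
  have hβ := hW.beta_pos
  have hd : ∀ n, dist (x.1.1 n) (z.1.1 n) ≤ β :=
    dist_le_of_mem hε (mem_self hW hε0 x.1) hz
  -- a uniform bound on the coordinates
  obtain ⟨ρ, hρ, h⟩ := coord_of_zero hW (half_pos hε0)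
  obtain ⟨j, hj⟩ := exists_pow_lt_of_lt_one (div_pos hρ (half_pos hβ)) hW.gamma_lt_one
  have hjK : dist (x.1.1 (0 + j * K)) (z.1.1 (0 + j * K)) < ρ := by
    refine (dist_coord_mul_K hW hd 0 j).trans_lt ?_
    have h1 : γ ^ (j * K) ≤ γ ^ j :=
      pow_le_pow_of_le_one hW.gamma_pos.le hW.gamma_lt_one.le (Nat.le_mul_of_pos_right _ hW.K_pos)
    have h2 : dist (x.1.1 0) (z.1.1 0) ≤ β / 2 := (hz.1 0).le.trans hε
    calc γ ^ (j * K) * dist (x.1.1 0) (z.1.1 0) ≤ γ ^ j * (β / 2) :=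
          mul_le_mul h1 h2 dist_nonneg (pow_pos hW.gamma_pos j).le
      _ < ρ := (lt_div_iff₀ (half_pos hβ)).1 hj
  rw [zero_add] at hjK
  have htail := h x.1 z.1 hd (j * K) hjK
  obtain ⟨c, hc, hcoord⟩ : ∃ c < ε, ∀ n, dist (x.1.1 n) (z.1.1 n) ≤ c := by
    have hfin : ∀ m : ℕ, ∃ c < ε, ∀ n < m, dist (x.1.1 n) (z.1.1 n) ≤ c := by
      intro m
      induction m with
      | zero => exact ⟨ε / 2, half_lt_self hε0, fun n hn => absurd hn (Nat.not_lt_zero n)⟩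
      | succ m ih =>
        obtain ⟨c, hc, h⟩ := ih
        refine ⟨max c (dist (x.1.1 m) (z.1.1 m)), max_lt hc (hz.1 m), fun n hn => ?_⟩
        rcases Nat.lt_succ_iff_lt_or_eq.1 hn with h' | rfl
        · exact (h n h').trans (le_max_left _ _)
        · exact le_max_right _ _
    obtain ⟨c, hc, h⟩ := hfin (j * K)
    refine ⟨max c (ε / 2), max_lt hc (half_lt_self hε0), fun n => ?_⟩
    rcases Nat.lt_or_ge n (j * K) with h' | h'
    · exact (h n h').trans (le_max_left _ _)
    · have := htail (n - j * K)
      rw [Nat.add_sub_cancel' h'] at this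
      exact this.le.trans (le_max_right _ _)
  have hz2 : distX g γ K x.1 z.1 < ε := hz.2
  refine ⟨min (ε - c) (ε - distX g γ K x.1 z.1), lt_min (by linarith) (by linarith), ?_⟩
  refine fun y hy => ⟨fun n => ?_, ?_⟩
  · have h1 := (hy.1 n).trans_le (min_le_left _ _)
    have h2 := dist_triangle (x.1.1 n) (z.1.1 n) (y.1.1 n)
    linarith [hcoord n]
  · have h1 := hy.2.trans_le (min_le_right _ _)
    have h2 := distX_triangle (K := K) hW.gamma_pos hW.gamma_lt_one x.1 z.1 y.1
    linarith

/-- Transport of open sets along the identification of two local unstable sets through `π₀`. -/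
theorem isOpen_transport (hW : IsPresolenoid g β γ K) (hε : ε ≤ β / 2)
    {x : UnstableSpace g γ K P} {A A' B : Set (UnstableSpace g γ K P)} (hA : IsOpen A)
    (hAA' : A ⊆ A') (hA' : A' ⊆ unstableBall x ε) (hB : IsOpen B)
    (hBA : piZero '' B ⊆ piZero '' A') :
    IsOpen {b | b ∈ B ∧ piZero b ∈ piZero '' A} := by
  rintro b ⟨hb, a, ha, hab⟩
  obtain ⟨η, hη, hηA⟩ := hA a ha
  obtain ⟨η', hη', hcoord⟩ := mem_of_coord hW hη
  obtain ⟨ρ, hρ, hzero⟩ := coord_of_zero hW hη'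
  obtain ⟨δ, hδ, hδB⟩ := hB b hb
  refine ⟨min δ ρ, lt_min hδ hρ, fun y hy => ?_⟩
  have hyB : y ∈ B := hδB y ⟨fun n => (hy.1 n).trans_le (min_le_left _ _),
    hy.2.trans_le (min_le_left _ _)⟩
  obtain ⟨t, ht, hty⟩ := hBA ⟨y, hyB, rfl⟩
  refine ⟨hyB, t, hηA t (hcoord _ _ fun n => ?_), hty⟩
  have hd := dist_le_of_mem hε (hA' (hAA' ha)) (hA' ht)
  have := hzero a.1 t.1 hd 0 (by
    have e1 : a.1.1 0 = b.1.1 0 := hab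
    have e2 : t.1.1 0 = y.1.1 0 := hty
    rw [e1, e2]
    exact (hy.1 0).trans_le (min_le_right _ _)) n
  rwa [zero_add] at this

/-- A symmetric form of the relation `∼₀`. -/
theorem relZero_iff (hW : IsPresolenoid g β γ K) (hε0 : 0 < ε) (hε : ε ≤ β / 2)
    (x y : UnstableSpace g γ K P) :
    RelZero ε x y ↔ piZero x = piZero y ∧ ∃ A B : Set (UnstableSpace g γ K P),
      IsOpen A ∧ IsOpen B ∧ x ∈ A ∧ y ∈ B ∧ A ⊆ unstableBall x ε ∧ B ⊆ unstableBall y ε ∧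
        piZero '' A = piZero '' B := by
  constructor
  · rintro ⟨hxy, δ, hδ, hδε, U, hU, hUy, h⟩
    have hxδ : x ∈ unstableBall x δ := mem_self hW hδ x.1
    refine ⟨hxy, unstableBall x δ, U, isOpen_unstableBall hW (hδε.le.trans hε) x, hU, hxδ, ?_,
      fun z hz => ⟨fun n => (hz.1 n).trans hδε, hz.2.trans hδε⟩, hUy, h⟩
    have hx : piZero x ∈ piZero '' U := h ▸ mem_image_of_mem _ hxδ
    obtain ⟨u, hu, hux⟩ := hx
    have : u = y := injOn_piZero hW hε y (hUy hu) (mem_self hW hε0 y.1) (hux.trans hxy)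
    exact this ▸ hu
  · rintro ⟨hxy, A, B, hA, hB, hxA, hyB, hAx, hBy, h⟩
    refine ⟨hxy, ?_⟩
    obtain ⟨δ, hδ, hδA⟩ := hA x hxA
    have hsub : unstableBall x (min δ (ε / 2)) ⊆ A := fun z hz =>
      hδA z ⟨fun n => (hz.1 n).trans_le (min_le_left _ _), hz.2.trans_le (min_le_left _ _)⟩
    have hlt : min δ (ε / 2) < ε := (min_le_right _ _).trans_lt (half_lt_self hε0)
    refine ⟨min δ (ε / 2), lt_min hδ (half_pos hε0), hlt,
      {b | b ∈ B ∧ piZero b ∈ piZero '' unstableBall x (min δ (ε / 2))},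
      isOpen_transport hW hε (isOpen_unstableBall hW (hlt.le.trans hε) x) hsub hAx hB h.ge,
      fun z hz => hBy hz.1, ?_⟩
    ext t
    constructor
    · intro ht
      obtain ⟨b, hb, rfl⟩ := h.le (image_mono hsub ht)
      exact ⟨b, ⟨hb, ht⟩, rfl⟩
    · rintro ⟨b, ⟨_, hb⟩, rfl⟩
      exact hb

theorem relZero_equivalence (hW : IsPresolenoid g β γ K) (hε0 : 0 < ε) (hε : ε ≤ β / 2) :
    Equivalence (RelZero ε : UnstableSpace g γ K P → UnstableSpace g γ K P → Prop) where
  refl x := (relZero_iff hW hε0 hε x x).2 ⟨rfl, unstableBall x ε, unstableBall x ε,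
    isOpen_unstableBall hW hε x, isOpen_unstableBall hW hε x, mem_self hW hε0 x.1,
    mem_self hW hε0 x.1, subset_rfl, subset_rfl, rfl⟩
  symm {x y} h := by
    obtain ⟨hxy, A, B, hA, hB, hxA, hyB, hAx, hBy, h⟩ := (relZero_iff hW hε0 hε x y).1 h
    exact (relZero_iff hW hε0 hε y x).2 ⟨hxy.symm, B, A, hB, hA, hyB, hxA, hBy, hAx, h.symm⟩
  trans {x y z} h1 h2 := by
    obtain ⟨hxy, A, B, hA, hB, hxA, hyB, hAx, hBy, h⟩ := (relZero_iff hW hε0 hε x y).1 h1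
    obtain ⟨hyz, C, D, hC, hD, hyC, hzD, hCy, hDz, h'⟩ := (relZero_iff hW hε0 hε y z).1 h2
    refine (relZero_iff hW hε0 hε x z).2 ⟨hxy.trans hyz,
      {a | a ∈ A ∧ piZero a ∈ piZero '' (B ∩ C)}, {d | d ∈ D ∧ piZero d ∈ piZero '' (B ∩ C)},
      isOpen_transport hW hε (hB.inter hC) inter_subset_left hBy hA h.le,
      isOpen_transport hW hε (hB.inter hC) inter_subset_right hCy hD h'.ge,
      ⟨hxA, y, ⟨hyB, hyC⟩, hxy.symm⟩, ⟨hzD, y, ⟨hyB, hyC⟩, hyz⟩,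
      fun a ha => hAx ha.1, fun d hd => hDz hd.1, ?_⟩
    have e1 : piZero '' {a | a ∈ A ∧ piZero a ∈ piZero '' (B ∩ C)} = piZero '' (B ∩ C) := by
      ext t
      constructor
      · rintro ⟨a, ⟨_, ha⟩, rfl⟩
        exact ha
      · intro ht
        obtain ⟨a, ha, rfl⟩ := h.ge (image_mono inter_subset_left ht)
        exact ⟨a, ⟨ha, ht⟩, rfl⟩
    have e2 : piZero '' {d | d ∈ D ∧ piZero d ∈ piZero '' (B ∩ C)} = piZero '' (B ∩ C) := by
      ext t
      constructor
      · rintro ⟨a, ⟨_, ha⟩, rfl⟩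
        exact ha
      · intro ht
        obtain ⟨a, ha, rfl⟩ := h'.le (image_mono inter_subset_right ht)
        exact ⟨a, ⟨ha, ht⟩, rfl⟩
    rw [e1, e2]

theorem phi_mem_unstableSet (hP : phi g '' P = P) {x : Solenoid g}
    (hx : x ∈ unstableSet g γ K P) : phi g x ∈ unstableSet g γ K P := by
  obtain ⟨p, hp, h⟩ := hx
  refine ⟨phi g p, hP ▸ mem_image_of_mem _ hp, ?_⟩
  refine (tendsto_add_atTop_iff_nat 1).1 ?_
  simp only [Function.iterate_succ_apply, Equiv.symm_apply_apply]
  exact h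

theorem symm_mem_unstableSet (hP : phi g '' P = P) {x : Solenoid g}
    (hx : x ∈ unstableSet g γ K P) : (phi g).symm x ∈ unstableSet g γ K P := by
  obtain ⟨p, hp, h⟩ := hx
  rw [← hP] at hp
  obtain ⟨p', hp', rfl⟩ := hp
  refine ⟨p', hp', ?_⟩
  have h' := (tendsto_add_atTop_iff_nat 1).2 h
  simp only [Function.iterate_succ_apply, Equiv.symm_apply_apply] at h'
  exact h'

theorem dist_symm_lt {x y : Solenoid g} {ρ : ℝ}
    (h : y ∈ localUnstable g γ K (phi g x) ρ) (n : ℕ) :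
    dist (x.1 n) (((phi g).symm y).1 n) < ρ := by
  have h1 := h.1 (n + 1)
  have e : (phi g x).1 (n + 1) = x.1 n := x.2 n
  rwa [e] at h1

end Helpers

/-- The restriction of `φ` to `X^u(P)`, for a `φ`-invariant set `P`. -/
def phiRestrict {Y : Type*} [MetricSpace Y] [CompactSpace Y] {g : Y → Y} (γ : ℝ) (K : ℕ)
    {P : Set (Solenoid g)} (hP : phi g '' P = P) (x : UnstableSpace g γ K P) :
    UnstableSpace g γ K P :=
  ⟨phi g x.1, phi_mem_unstableSet hP x.2⟩

section Helpers

set_option linter.unusedSectionVars false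

variable {Y : Type*} [MetricSpace Y] [CompactSpace Y] {g : Y → Y} {β γ ε : ℝ} {K : ℕ}
  {P : Set (Solenoid g)}

theorem phiRestrict_continuous (hW : IsPresolenoid g β γ K) (hP : phi g '' P = P) :
    Continuous (phiRestrict γ K hP) := by
  refine ⟨fun U hU x hx => ?_⟩
  obtain ⟨δ, hδ, h⟩ := hU _ hx
  obtain ⟨ρ, hρ, h1⟩ := mem_of_coord hW hδ
  obtain ⟨ρ', hρ', h2⟩ := exists_modulus hW.continuous 1 hρ
  exact ⟨ρ', hρ', fun y hy => h _ (h1 _ _ fun n => h2 1 le_rfl _ _ (hy.1 n))⟩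

theorem phiRestrict_isOpenMap (hW : IsPresolenoid g β γ K) (hP : phi g '' P = P) :
    IsOpenMap (phiRestrict (g := g) γ K hP) := by
  rintro U hU _ ⟨x, hx, rfl⟩
  obtain ⟨δ, hδ, h⟩ := hU _ hx
  obtain ⟨ρ, hρ, h1⟩ := mem_of_coord hW hδ
  refine ⟨ρ, hρ, fun y hy => ?_⟩
  refine ⟨⟨(phi g).symm y.1, symm_mem_unstableSet hP y.2⟩, h _ (h1 _ _ (dist_symm_lt hy)), ?_⟩
  exact Subtype.ext ((phi g).apply_symm_apply y.1)

theorem relZero_phi (hW : IsPresolenoid g β γ K) (hP : phi g '' P = P) (hε0 : 0 < ε)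
    (hε : ε ≤ β / 2) {x y : UnstableSpace g γ K P} (h : RelZero ε x y) :
    RelZero ε (phiRestrict γ K hP x) (phiRestrict γ K hP y) := by
  obtain ⟨hxy, A, B, hA, hB, hxA, hyB, hAx, hBy, h⟩ := (relZero_iff hW hε0 hε x y).1 h
  have hcont := phiRestrict_continuous hW hP
  have hpi : ∀ z : UnstableSpace g γ K P, piZero (phiRestrict γ K hP z) = g (piZero z) :=
    fun _ => rfl
  set A' := A ∩ phiRestrict γ K hP ⁻¹' unstableBall (phiRestrict γ K hP x) ε with hA'
  set B' := B ∩ phiRestrict γ K hP ⁻¹' unstableBall (phiRestrict γ K hP y) ε with hB'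
  have oA : IsOpen A' := hA.inter ((isOpen_unstableBall hW hε _).preimage hcont)
  have oB : IsOpen B' := hB.inter ((isOpen_unstableBall hW hε _).preimage hcont)
  have mA : x ∈ A' := ⟨hxA, mem_self hW hε0 _⟩
  have mB : y ∈ B' := ⟨hyB, mem_self hW hε0 _⟩
  have oA2 : IsOpen {a | a ∈ A' ∧ piZero a ∈ piZero '' B'} :=
    isOpen_transport hW hε oB inter_subset_left hBy oA
      ((image_mono inter_subset_left).trans h.le)
  have oB2 : IsOpen {b | b ∈ B' ∧ piZero b ∈ piZero '' A'} :=
    isOpen_transport hW hε oA inter_subset_left hAx oB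
      ((image_mono inter_subset_left).trans h.ge)
  refine (relZero_iff hW hε0 hε _ _).2 ⟨by rw [hpi, hpi, hxy],
    _, _, phiRestrict_isOpenMap hW hP _ oA2, phiRestrict_isOpenMap hW hP _ oB2,
    ⟨x, ⟨mA, y, mB, hxy.symm⟩, rfl⟩, ⟨y, ⟨mB, x, mA, hxy⟩, rfl⟩, ?_, ?_, ?_⟩
  · rintro _ ⟨a, ha, rfl⟩
    exact ha.1.2
  · rintro _ ⟨b, hb, rfl⟩
    exact hb.1.2
  · ext t
    constructor
    · rintro ⟨_, ⟨a, ⟨ha, b, hb, hab⟩, rfl⟩, rfl⟩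
      exact ⟨_, ⟨b, ⟨hb, a, ha, hab.symm⟩, rfl⟩, by rw [hpi, hpi, hab]⟩
    · rintro ⟨_, ⟨b, ⟨hb, a, ha, hab⟩, rfl⟩, rfl⟩
      exact ⟨_, ⟨a, ⟨ha, b, hb, hab.symm⟩, rfl⟩, by rw [hpi, hpi, hab]⟩

end Helpers

/-- The relation `∼₀` as an equivalence relation on `X^u(P)`. -/
def zeroSetoid {Y : Type*} [MetricSpace Y] [CompactSpace Y] {g : Y → Y} {β γ ε : ℝ} {K : ℕ}
    (hW : IsPresolenoid g β γ K) (hε0 : 0 < ε) (hε : ε ≤ β / 2) (P : Set (Solenoid g)) :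
    Setoid (UnstableSpace g γ K P) :=
  ⟨RelZero ε, relZero_equivalence hW hε0 hε⟩

/-- The space `X^u(P)/∼₀`; it carries the quotient topology. -/
def QuotientZero {Y : Type*} [MetricSpace Y] [CompactSpace Y] {g : Y → Y} {β γ ε : ℝ} {K : ℕ}
    (hW : IsPresolenoid g β γ K) (hε0 : 0 < ε) (hε : ε ≤ β / 2) (P : Set (Solenoid g)) :
    Type _ :=
  Quotient (zeroSetoid hW hε0 hε P)

instance {Y : Type*} [MetricSpace Y] [CompactSpace Y] {g : Y → Y} {β γ ε : ℝ} {K : ℕ}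
    (hW : IsPresolenoid g β γ K) (hε0 : 0 < ε) (hε : ε ≤ β / 2) (P : Set (Solenoid g)) :
    TopologicalSpace (QuotientZero hW hε0 hε P) :=
  instTopologicalSpaceQuotient

/-- The map `[x] ↦ [(g(x₀), g(x₁), …)]` induced by `φ` on `X^u(P)/∼₀`. -/
def gTilde {Y : Type*} [MetricSpace Y] [CompactSpace Y] {g : Y → Y} {β γ ε : ℝ} {K : ℕ}
    (hW : IsPresolenoid g β γ K) (hε0 : 0 < ε) (hε : ε ≤ β / 2) {P : Set (Solenoid g)}
    (hP : phi g '' P = P) : QuotientZero hW hε0 hε P → QuotientZero hW hε0 hε P :=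
  Quotient.map (phiRestrict γ K hP) fun _ _ h => relZero_phi hW hP hε0 hε h

end Wieler

end

/-!
Let `π₀ : X → Y` be the projection to the `0`-th coordinate.

`(X, φ)` is mixing exactly when `(Y, g)` is: `π₀` is a continuous surjection with `π₀ φ = g π₀`, and
in an inverse limit every open set is a union of sets `{x | xₙ ∈ W}` with `W` open in `Y`; two such
sets can be written with the same index `n`, where a point of `Y` with the required orbit lifts to a
thread through it (`isMixing_of_isMixing_phi`, `isMixing_phi_of_isMixing`).

The relation to `X^u(P)/∼₀` rests on a lifting property of local unstable sets
(`exists_mem_localUnstable`): iterating Wieler's second axiom along a thread `c`, every `w` close to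
`c_K` yields a thread `y ∈ X^u(c, η)` with `y₀ = g^K(w)`. It has two consequences.

* If `b, c ∈ X^u(P)` satisfy `b_K = c_K`, then small local unstable sets of `b` project under `π₀`
  into local unstable sets of `c`, and conversely, so `b ∼₀ c` (`relZero_of_coord_eq`). Hence `∼₀`
  only sees finitely many coordinates.
* An open neighbourhood of `x` in `X^u(P)` contains points `y` with `y_K = g^K(w)` for every `w` in
  a ball of `Y` around `x_{2K}` (`exists_mem_of_isOpen`).

If `g` is mixing, some `w` in the ball of `x` has `g^n(w)` in the ball of `z`; lifting `w` to `y` near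
`x` and `g^n(w)` to `y'` near `z`, the points `φ^n(y)` and `y'` agree in coordinate `K`, so their
classes coincide. This is mixing of the quotient (`isMixing_gTilde_of_isMixing`). Conversely, `π₀`
induces a continuous semiconjugacy from the quotient to `(Y, g)`, whose image is dense as soon as
`X^u(P)` is dense in `X`, and mixing passes to such factors
(`isMixing_of_isMixing_gTilde`).
-/

open Set Filter Topology

namespace Wieler

/-! ### Threads of the inverse limit -/

/-- A sequence of successive `g^K`-preimages extends to a thread: since `n ≤ n * K`, the entry
`u n` at place `n * K` determines the coordinate `n`. -/
theorem exists_solenoid_of_iterate {Y : Type*} {g : Y → Y} {K : ℕ} (hK : 0 < K) (u : ℕ → Y)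
    (hu : ∀ j, g^[K] (u (j + 1)) = u j) :
    ∃ y : Solenoid g, ∀ j, y.1 (j * K) = u j := by
  have hle : ∀ n : ℕ, n ≤ n * K := fun n => Nat.le_mul_of_pos_right n hK
  have hiter : ∀ i j, g^[i * K] (u (j + i)) = u j := by
    intro i
    induction i with
    | zero => intro j; simp
    | succ i ih =>
      intro j
      rw [add_mul, one_mul, Function.iterate_add_apply, ← add_assoc, hu, ih]
  refine ⟨⟨fun n => g^[n * K - n] (u n), fun n => ?_⟩, fun j => ?_⟩
  · have e : (n + 1) * K - (n + 1) + 1 = (n * K - n) + K := by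
      have := hle n
      rw [add_mul, one_mul]
      omega
    rw [← Function.iterate_succ_apply' g, Nat.succ_eq_add_one, e, Function.iterate_add_apply, hu]
  · have h := hiter (j * K - j) j
    rw [Nat.add_sub_cancel' (hle j)] at h
    have e : (j * K) * K - j * K = (j * K - j) * K := (Nat.sub_mul _ _ _).symm
    change g^[(j * K) * K - j * K] (u (j * K)) = u j
    rw [e, h]

theorem exists_solenoid_coord_eq {Y : Type*} [MetricSpace Y] [CompactSpace Y] {g : Y → Y}
    (hg : Function.Surjective g) (n : ℕ) (w : Y) : ∃ x : Solenoid g, x.1 n = w := by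
  obtain ⟨s, hs⟩ := hg.hasRightInverse
  obtain ⟨x, hx⟩ := exists_solenoid_of_iterate (g := g) one_pos (fun j => s^[j] w) fun j => by
    rw [Function.iterate_one, Function.iterate_succ_apply', hs]
  refine ⟨(phi g)^[n] x, ?_⟩
  rw [phi_iterate_coord]
  have h := iterate_coord x n 0
  have h0 := hx 0
  rw [zero_add] at h
  rw [zero_mul] at h0
  rw [h, h0]
  rfl

theorem continuous_coord {Y : Type*} [TopologicalSpace Y] (g : Y → Y) (n : ℕ) :
    Continuous fun x : Solenoid g => x.1 n :=
  (continuous_apply n).comp continuous_subtype_val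

/-- In the inverse limit, the sets `{y | y m ∈ W}` form a neighbourhood base, and `m` may be taken
arbitrarily large. -/
theorem exists_coord_preimage_subset {Y : Type*} [MetricSpace Y] [CompactSpace Y] {g : Y → Y}
    (hg : Continuous g) {U : Set (Solenoid g)} (hU : IsOpen U) {x : Solenoid g} (hx : x ∈ U) :
    ∃ n : ℕ, ∀ m ≥ n, ∃ W : Set Y, IsOpen W ∧ x.1 m ∈ W ∧ ∀ y : Solenoid g, y.1 m ∈ W → y ∈ U := by
  obtain ⟨O, hO, rfl⟩ := isOpen_induced_iff.1 hU
  obtain ⟨I, u, hu, hsub⟩ := isOpen_pi_iff.1 hO x.1 hx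
  refine ⟨I.sup id, fun m hm => ?_⟩
  have hle : ∀ i ∈ I, i ≤ m := fun i hi => (Finset.le_sup (f := id) hi).trans hm
  have hcoord : ∀ i ∈ I, ∀ y : Solenoid g, g^[m - i] (y.1 m) = y.1 i := fun i hi y => by
    have := iterate_coord y (m - i) i
    rwa [Nat.add_sub_cancel' (hle i hi)] at this
  refine ⟨⋂ i ∈ I, g^[m - i] ⁻¹' u i,
    isOpen_biInter_finset fun i hi => (hu i hi).1.preimage (hg.iterate _), ?_, fun y hy => ?_⟩
  · refine mem_iInter₂.2 fun i hi => ?_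
    rw [mem_preimage, hcoord i hi]
    exact (hu i hi).2
  · refine hsub fun i hi => ?_
    have := mem_iInter₂.1 hy i hi
    rwa [mem_preimage, hcoord i hi] at this

/-! ### Mixing of the solenoid and of its base -/

/-- Mixing passes along a continuous semiconjugacy with dense range. -/
theorem IsMixing.of_semiconj {Z Y : Type*} [TopologicalSpace Z] [TopologicalSpace Y] {f : Z → Z}
    {g : Y → Y} (hf : IsMixing f) {π : Z → Y} (hπ : Continuous π) (hd : DenseRange π)
    (h : Function.Semiconj π f g) : IsMixing g := by
  intro U V hU hV hUne hVne
  obtain ⟨N, hN⟩ := hf _ _ (hU.preimage hπ) (hV.preimage hπ)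
    (hd.exists_mem_open hU hUne) (hd.exists_mem_open hV hVne)
  refine ⟨N, fun n hn => ?_⟩
  obtain ⟨_, ⟨x, hx, rfl⟩, hxV⟩ := hN n hn
  refine ⟨g^[n] (π x), mem_image_of_mem _ hx, ?_⟩
  rw [← (h.iterate_right n) x]
  exact hxV

theorem isMixing_of_isMixing_phi {Y : Type*} [MetricSpace Y] [CompactSpace Y] {g : Y → Y}
    (hs : Function.Surjective g) (h : IsMixing (phi g)) : IsMixing g :=
  h.of_semiconj (continuous_coord g 0)
    (Function.Surjective.denseRange fun w => exists_solenoid_coord_eq hs 0 w) fun _ => rfl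

theorem isMixing_phi_of_isMixing {Y : Type*} [MetricSpace Y] [CompactSpace Y] {g : Y → Y}
    (hg : Continuous g) (hs : Function.Surjective g) (h : IsMixing g) : IsMixing (phi g) := by
  rintro U V hU hV ⟨x, hx⟩ ⟨z, hz⟩
  obtain ⟨n₁, h₁⟩ := exists_coord_preimage_subset hg hU hx
  obtain ⟨n₂, h₂⟩ := exists_coord_preimage_subset hg hV hz
  obtain ⟨W, hW, hxW, hWU⟩ := h₁ (max n₁ n₂) (le_max_left _ _)
  obtain ⟨W', hW', hzW', hWV⟩ := h₂ (max n₁ n₂) (le_max_right _ _)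
  obtain ⟨N, hN⟩ := h W W' hW hW' ⟨_, hxW⟩ ⟨_, hzW'⟩
  refine ⟨N, fun n hn => ?_⟩
  obtain ⟨_, ⟨w, hw, rfl⟩, hwW'⟩ := hN n hn
  obtain ⟨y, hy⟩ := exists_solenoid_coord_eq hs (max n₁ n₂) w
  refine ⟨(phi g)^[n] y, mem_image_of_mem _ (hWU y (hy ▸ hw)), hWV _ ?_⟩
  rw [phi_iterate_coord, hy]
  exact hwW'

/-! ### Lifting points of the base to local unstable sets -/

theorem distX_nonneg {Y : Type*} [MetricSpace Y] {g : Y → Y} {γ : ℝ} {K : ℕ} (hγ : 0 < γ)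
    (x y : Solenoid g) : 0 ≤ distX g γ K x y :=
  Finset.sum_nonneg fun i _ => mul_nonneg (pow_pos hγ i).le
    (Real.iSup_nonneg fun n => mul_nonneg (pow_pos hγ n).le dist_nonneg)

theorem symm_iterate_coord {Y : Type*} {g : Y → Y} (i : ℕ) (x : Solenoid g) (n : ℕ) :
    ((phi g).symm^[i] x).1 n = x.1 (n + i) := by
  induction i generalizing x with
  | zero => rfl
  | succ i ih => rw [Function.iterate_succ_apply, ih]; rfl

theorem continuous_piZero {Y : Type*} [MetricSpace Y] {g : Y → Y} {γ : ℝ} {K : ℕ}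
    {P : Set (Solenoid g)} : Continuous (piZero : UnstableSpace g γ K P → Y) := by
  refine ⟨fun O hO x hx => ?_⟩
  obtain ⟨δ, hδ, h⟩ := Metric.isOpen_iff.1 hO _ hx
  exact ⟨δ, hδ, fun y hy => h (by rw [Metric.mem_ball, dist_comm]; exact hy.1 0)⟩

section Unstable

variable {Y : Type*} [MetricSpace Y] [CompactSpace Y] {g : Y → Y} {β γ ε : ℝ} {K : ℕ}
  {P : Set (Solenoid g)}

/-- Wieler's second axiom, iterated along the thread `c`. -/
theorem exists_mem_localUnstable (hW : IsPresolenoid g β γ K) {η : ℝ} (hη : 0 < η) :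
    ∃ ρ > 0, ∀ (c : Solenoid g) (w : Y), dist w (c.1 K) < ρ →
      ∃ y ∈ localUnstable g γ K c η, y.1 0 = g^[K] w := by
  obtain ⟨ρ₁, hρ₁, hmem⟩ := mem_of_coord hW hη
  obtain ⟨ρ₂, hρ₂, hmod⟩ := exists_modulus hW.continuous (2 * K) hρ₁
  have hβ := hW.beta_pos
  refine ⟨min ρ₂ β, lt_min hρ₂ hβ, fun c w hw => ?_⟩
  set ρ := min ρ₂ β with hρ
  have hρ0 : 0 < ρ := lt_min hρ₂ hβ
  have hstep : ∀ (j : ℕ) (v : Y), dist v (c.1 ((j + 1) * K)) < ρ →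
      ∃ v', dist v' (c.1 ((j + 1 + 1) * K)) < ρ ∧ g^[2 * K] v' = g^[K] v := by
    intro j v hv
    have e : g^[K] (c.1 ((j + 1 + 1) * K)) = c.1 ((j + 1) * K) := by
      rw [add_mul (j + 1) 1 K, one_mul, iterate_coord]
    obtain ⟨v', hv', h⟩ := hW.axiom_two (c.1 ((j + 1 + 1) * K)) ρ hρ0 (min_le_right _ _)
      (mem_image_of_mem _ (show v ∈ Metric.ball _ ρ by rw [e]; exact hv))
    exact ⟨v', (Metric.mem_ball.1 hv').trans_le
      (mul_le_of_le_one_left hρ0.le hW.gamma_lt_one.le), h⟩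
  choose! next hnext_dist hnext using hstep
  let v : ℕ → Y := fun j => Nat.rec w (fun j a => next j a) j
  have hv : ∀ j, dist (v j) (c.1 ((j + 1) * K)) < ρ := by
    intro j
    induction j with
    | zero => simpa [v] using hw
    | succ j ih => exact hnext_dist j _ ih
  -- The points `v j` need not form a thread, but their images under `g^K` do.
  obtain ⟨y, hy⟩ := exists_solenoid_of_iterate hW.K_pos (fun j => g^[K] (v j)) fun j => by
    rw [← Function.iterate_add_apply, ← two_mul]
    exact hnext j _ (hv j)
  refine ⟨y, hmem c y fun n => ?_, ?_⟩
  · -- Coordinate `n` is an iterate of order at most `2 * K` of `v j`, where `j * K` is the first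
    -- multiple of `K` beyond `n`.
    have hn : n + (K - n % K) = (n / K + 1) * K := by
      have h1 := Nat.div_add_mod n K
      have h2 := Nat.mod_lt n hW.K_pos
      rw [add_mul, one_mul, mul_comm (n / K) K]
      omega
    have hyn : y.1 n = g^[(K - n % K) + K] (v (n / K + 1)) := by
      rw [← iterate_coord y (K - n % K) n, hn, hy, ← Function.iterate_add_apply]
    have hcn : c.1 n = g^[(K - n % K) + K] (c.1 ((n / K + 1 + 1) * K)) := by
      rw [add_mul (n / K + 1) 1 K, one_mul, Function.iterate_add_apply, iterate_coord, ← hn,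
        iterate_coord]
    rw [hyn, hcn, dist_comm]
    exact hmod _ (by omega) _ _ ((hv (n / K + 1)).trans_le (min_le_left _ _))
  · have h0 := hy 0
    rwa [zero_mul] at h0

theorem unstableEquiv_of_mem_localUnstable (hW : IsPresolenoid g β γ K) {x y : Solenoid g}
    (hε : ε ≤ β / 2) (hy : y ∈ localUnstable g γ K x ε) : UnstableEquiv g γ K y x := by
  have hε0 : 0 < ε := dist_nonneg.trans_lt (hy.1 0)
  have hβ := hW.beta_pos
  have hd : ∀ n, dist (y.1 n) (x.1 n) ≤ β := dist_le_of_mem hε hy (mem_self hW hε0 x)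
  refine Metric.tendsto_atTop.2 fun η hη => ?_
  obtain ⟨ρ, hρ, hmem⟩ := mem_of_coord hW hη
  obtain ⟨ρ', hρ', hzero⟩ := coord_of_zero hW hρ
  obtain ⟨j, hj⟩ := exists_pow_lt_of_lt_one (div_pos hρ' hβ) hW.gamma_lt_one
  have hjK : dist (y.1 (0 + j * K)) (x.1 (0 + j * K)) < ρ' :=
    calc dist (y.1 (0 + j * K)) (x.1 (0 + j * K))
        ≤ γ ^ (j * K) * dist (y.1 0) (x.1 0) := dist_coord_mul_K hW hd 0 j
      _ ≤ γ ^ j * β := mul_le_mul (pow_le_pow_of_le_one hW.gamma_pos.le hW.gamma_lt_one.le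
          (Nat.le_mul_of_pos_right _ hW.K_pos)) (hd 0) dist_nonneg (pow_pos hW.gamma_pos j).le
      _ < ρ' := (lt_div_iff₀ hβ).1 hj
  rw [zero_add] at hjK
  refine ⟨j * K, fun m hm => ?_⟩
  rw [Real.dist_eq, sub_zero, abs_of_nonneg (distX_nonneg hW.gamma_pos _ _)]
  refine (hmem _ _ fun n => ?_).2
  rw [symm_iterate_coord, symm_iterate_coord]
  have h := hzero y x hd (j * K) hjK (n + m - j * K)
  rwa [Nat.add_sub_cancel' (by omega)] at h

theorem mem_unstableSet_of_mem_localUnstable (hW : IsPresolenoid g β γ K) {x y : Solenoid g}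
    (hε : ε ≤ β / 2) (hx : x ∈ unstableSet g γ K P) (hy : y ∈ localUnstable g γ K x ε) :
    y ∈ unstableSet g γ K P := by
  obtain ⟨p, hp, hxp⟩ := hx
  refine ⟨p, hp, squeeze_zero (fun n => distX_nonneg hW.gamma_pos _ _)
    (fun n => distX_triangle hW.gamma_pos hW.gamma_lt_one _ ((phi g).symm^[n] x) _) ?_⟩
  simpa using (unstableEquiv_of_mem_localUnstable hW hε hy).add hxp

/-! ### The relation `∼₀` -/

/-- For `b, c ∈ X^u(P)` with the same coordinate `K`, the projection of a small local unstable set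
of `b` is contained in that of a given local unstable set of `c`. -/
theorem exists_image_unstableBall_subset (hW : IsPresolenoid g β γ K) {η : ℝ} (hη : 0 < η)
    (hηβ : η ≤ β / 2) :
    ∃ ρ > 0, ∀ b c : UnstableSpace g γ K P, b.1.1 K = c.1.1 K →
      ∀ δ ≤ ρ, piZero '' unstableBall b δ ⊆ piZero '' unstableBall c η := by
  obtain ⟨ρ, hρ, h⟩ := exists_mem_localUnstable hW hη
  refine ⟨ρ, hρ, fun b c hbc δ hδ => ?_⟩
  rintro _ ⟨y, hy, rfl⟩
  have hd : dist (y.1.1 K) (c.1.1 K) < ρ := by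
    rw [← hbc, dist_comm]
    exact (hy.1 K).trans_le hδ
  obtain ⟨y', hy', hy0⟩ := h c.1 (y.1.1 K) hd
  refine ⟨⟨y', mem_unstableSet_of_mem_localUnstable hW hηβ c.2 hy'⟩, hy', ?_⟩
  have e := iterate_coord y.1 K 0
  rw [zero_add] at e
  exact hy0.trans e

/-- The class of a point under `∼₀` is determined by its coordinate `K`. -/
theorem relZero_of_coord_eq (hW : IsPresolenoid g β γ K) (hε0 : 0 < ε) (hε : ε ≤ β / 2)
    {b c : UnstableSpace g γ K P} (hbc : b.1.1 K = c.1.1 K) : RelZero ε b c := by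
  obtain ⟨ρ₁, hρ₁, h₁⟩ := exists_image_unstableBall_subset (P := P) hW hε0 hε
  have hδ₁ : 0 < min ρ₁ ε := lt_min hρ₁ hε0
  have hδ₁ε : min ρ₁ ε ≤ ε := min_le_right _ _
  obtain ⟨ρ₂, hρ₂, h₂⟩ := exists_image_unstableBall_subset (P := P) hW hδ₁ (hδ₁ε.trans hε)
  have hδ₂ε : min ρ₂ (ε / 2) < ε := (min_le_right _ _).trans_lt (half_lt_self hε0)
  have hmono : ∀ (x : UnstableSpace g γ K P) {δ : ℝ}, δ ≤ ε →
      unstableBall x δ ⊆ unstableBall x ε := fun x δ hδ z hz =>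
    ⟨fun n => (hz.1 n).trans_le hδ, hz.2.trans_le hδ⟩
  refine ⟨?_, min ρ₂ (ε / 2), lt_min hρ₂ (half_pos hε0), hδ₂ε,
    {u | u ∈ unstableBall c (min ρ₁ ε) ∧ piZero u ∈ piZero '' unstableBall b (min ρ₂ (ε / 2))},
    isOpen_transport hW hε (isOpen_unstableBall hW (hδ₂ε.le.trans hε) b) (hmono b hδ₂ε.le)
      Subset.rfl (isOpen_unstableBall hW (hδ₁ε.trans hε) c)
      (h₁ c b hbc.symm _ (min_le_left _ _)),
    fun u hu => hmono c hδ₁ε hu.1, ?_⟩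
  · have eb := iterate_coord b.1 K 0
    have ec := iterate_coord c.1 K 0
    rw [zero_add] at eb ec
    exact eb.symm.trans ((congrArg _ hbc).trans ec)
  · ext t
    constructor
    · intro ht
      obtain ⟨u, hu, rfl⟩ := h₂ b c hbc _ (min_le_left _ _) ht
      exact ⟨u, ⟨hu, ht⟩, rfl⟩
    · rintro ⟨u, ⟨_, hu⟩, rfl⟩
      exact hu

/-- Neighbourhoods in `X^u(P)` see a whole ball of the base, through coordinate `K`. -/
theorem exists_mem_of_isOpen (hW : IsPresolenoid g β γ K) (hP : phi g '' P = P)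
    {U : Set (UnstableSpace g γ K P)} (hU : IsOpen U) {x : UnstableSpace g γ K P} (hx : x ∈ U) :
    ∃ ρ > 0, ∀ w : Y, dist w (x.1.1 (2 * K)) < ρ → ∃ y ∈ U, y.1.1 K = g^[K] w := by
  -- The lifting property is applied to `φ^{-K}(x)`, and the result is carried back by `φ^K`.
  obtain ⟨x', rfl⟩ : ∃ x' : UnstableSpace g γ K P, (phiRestrict γ K hP)^[K] x' = x := by
    have hs : Function.Surjective (phiRestrict (g := g) γ K hP) := fun y =>
      ⟨⟨(phi g).symm y.1, symm_mem_unstableSet hP y.2⟩,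
        Subtype.ext ((phi g).apply_symm_apply y.1)⟩
    exact hs.iterate K x
  have hcoord : ∀ (k : ℕ) (z : UnstableSpace g γ K P) (n : ℕ),
      ((phiRestrict γ K hP)^[k] z).1.1 n = g^[k] (z.1.1 n) := by
    intro k z n
    rw [← phi_iterate_coord]
    have h : Function.Semiconj Subtype.val (phiRestrict (g := g) γ K hP) (phi g) := fun _ => rfl
    exact congrArg (fun a : Solenoid g => a.1 n) ((h.iterate_right k) z)
  have hcK : ∀ (z : UnstableSpace g γ K P) (n : ℕ),
      ((phiRestrict γ K hP)^[K] z).1.1 (n + K) = z.1.1 n := fun z n => by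
    rw [hcoord, iterate_coord]
  obtain ⟨δ, hδ, hδU⟩ := hU.preimage ((phiRestrict_continuous hW hP).iterate K) x' hx
  have hη : 0 < min δ (β / 2) := lt_min hδ (half_pos hW.beta_pos)
  obtain ⟨ρ, hρ, h⟩ := exists_mem_localUnstable hW hη
  refine ⟨ρ, hρ, fun w hw => ?_⟩
  rw [two_mul, hcK] at hw
  obtain ⟨y, hy, hy0⟩ := h x'.1 w hw
  let y' : UnstableSpace g γ K P :=
    ⟨y, mem_unstableSet_of_mem_localUnstable hW (min_le_right _ _) x'.2 hy⟩
  refine ⟨(phiRestrict γ K hP)^[K] y', hδU y' ⟨fun n => (hy.1 n).trans_le (min_le_left _ _),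
    hy.2.trans_le (min_le_left _ _)⟩, ?_⟩
  have e := hcK y' 0
  rw [zero_add] at e
  exact e.trans hy0

/-! ### Mixing of the quotient -/

/-- The projection of `X^u(P)` onto `X^u(P)/∼₀`. -/
def quotientMk (hW : IsPresolenoid g β γ K) (hε0 : 0 < ε) (hε : ε ≤ β / 2) (P : Set (Solenoid g))
    (x : UnstableSpace g γ K P) : QuotientZero hW hε0 hε P :=
  Quotient.mk (zeroSetoid hW hε0 hε P) x

theorem continuous_quotientMk (hW : IsPresolenoid g β γ K) (hε0 : 0 < ε) (hε : ε ≤ β / 2) :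
    Continuous (quotientMk hW hε0 hε P) :=
  continuous_quotient_mk'

theorem semiconj_quotientMk (hW : IsPresolenoid g β γ K) (hε0 : 0 < ε) (hε : ε ≤ β / 2)
    (hP : phi g '' P = P) :
    Function.Semiconj (quotientMk hW hε0 hε P) (phiRestrict γ K hP) (gTilde hW hε0 hε hP) :=
  fun _ => rfl

theorem isMixing_gTilde_of_isMixing (hW : IsPresolenoid g β γ K) (hε0 : 0 < ε) (hε : ε ≤ β / 2)
    (hP : phi g '' P = P) (h : IsMixing g) : IsMixing (gTilde hW hε0 hε hP) := by
  rintro U V hU hV ⟨⟨x⟩, hx⟩ ⟨⟨z⟩, hz⟩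
  obtain ⟨ρ, hρ, hlift⟩ :=
    exists_mem_of_isOpen hW hP (hU.preimage (continuous_quotientMk hW hε0 hε)) hx
  obtain ⟨ρ', hρ', hlift'⟩ :=
    exists_mem_of_isOpen hW hP (hV.preimage (continuous_quotientMk hW hε0 hε)) hz
  obtain ⟨N, hN⟩ := h _ _ Metric.isOpen_ball Metric.isOpen_ball
    ⟨_, Metric.mem_ball_self hρ⟩ ⟨_, Metric.mem_ball_self hρ'⟩
  refine ⟨N, fun n hn => ?_⟩
  obtain ⟨_, ⟨w, hw, rfl⟩, hw'⟩ := hN n hn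
  obtain ⟨y, hyU, hy⟩ := hlift w hw
  obtain ⟨y', hyV, hy'⟩ := hlift' _ hw'
  refine ⟨_, mem_image_of_mem _ hyU, ?_⟩
  have hrel : RelZero ε ((phiRestrict γ K hP)^[n] y) y' := by
    refine relZero_of_coord_eq hW hε0 hε ?_
    have hs : Function.Semiconj (fun a : UnstableSpace g γ K P => a.1.1 K)
      (phiRestrict γ K hP) g := fun _ => rfl
    refine ((hs.iterate_right n) y).trans ?_
    rw [hy, hy', ← Function.iterate_add_apply, ← Function.iterate_add_apply, add_comm]
  have e : quotientMk hW hε0 hε P ((phiRestrict γ K hP)^[n] y) = quotientMk hW hε0 hε P y' :=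
    Quotient.sound hrel
  rw [← ((semiconj_quotientMk hW hε0 hε hP).iterate_right n) y, e]
  exact hyV

theorem isMixing_of_isMixing_gTilde (hW : IsPresolenoid g β γ K) (hε0 : 0 < ε) (hε : ε ≤ β / 2)
    (hP : phi g '' P = P) (hd : Dense (unstableSet g γ K P))
    (h : IsMixing (gTilde hW hε0 hε hP)) : IsMixing g := by
  let π : QuotientZero hW hε0 hε P → Y := Quotient.lift piZero fun _ _ hab => hab.1
  refine h.of_semiconj (π := π) (continuous_piZero.quotient_lift _) ?_ ?_
  · have hs : DenseRange fun x : Solenoid g => x.1 0 :=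
      Function.Surjective.denseRange fun w => exists_solenoid_coord_eq hW.surjective 0 w
    refine (hs.dense_image (continuous_coord g 0) hd).mono ?_
    rintro _ ⟨x, hx, rfl⟩
    exact ⟨quotientMk hW hε0 hε P ⟨x, hx⟩, rfl⟩
  · rintro ⟨x⟩
    rfl

end Unstable

end Wieler

theorem mainTheorem12 {Y : Type*} [MetricSpace Y] [CompactSpace Y] [Infinite Y] (g : Y → Y)
    (β γ : ℝ) (K : ℕ) (hW : Wieler.IsPresolenoid g β γ K)
    (P : Set (Wieler.Solenoid g)) (hPfin : P.Finite) (hPinv : Wieler.phi g '' P = P)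
    (hPper : ∀ p ∈ P, p ∈ Function.periodicPts (Wieler.phi g))
    (ε : ℝ) (hε0 : 0 < ε) (hε : ε ≤ β / 2) :
    (Wieler.IsMixing (Wieler.phi g) ↔ Wieler.IsMixing g) ∧
    (Wieler.IsMixing (Wieler.phi g) → Wieler.IsMixing (Wieler.gTilde hW hε0 hε hPinv)) ∧
    (Dense (Wieler.unstableSet g γ K P) →
      List.TFAE [Wieler.IsMixing (Wieler.phi g),
        Wieler.IsMixing (Wieler.gTilde hW hε0 hε hPinv),
        Wieler.IsMixing g]) := by
  have h13 : Wieler.IsMixing (Wieler.phi g) → Wieler.IsMixing g :=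
    Wieler.isMixing_of_isMixing_phi hW.surjective
  have h31 : Wieler.IsMixing g → Wieler.IsMixing (Wieler.phi g) :=
    Wieler.isMixing_phi_of_isMixing hW.continuous hW.surjective
  have h32 : Wieler.IsMixing g → Wieler.IsMixing (Wieler.gTilde hW hε0 hε hPinv) :=
    Wieler.isMixing_gTilde_of_isMixing hW hε0 hε hPinv
  refine ⟨⟨h13, h31⟩, fun h => h32 (h13 h), fun hd => ?_⟩
  tfae_have 1 → 3 := h13
  tfae_have 3 → 1 := h31
  tfae_have 3 → 2 := h32
  tfae_have 2 → 3 := Wieler.isMixing_of_isMixing_gTilde hW hε0 hε hPinv hd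
  tfae_finish
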